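/- **Setting.** Let $A\in\mathbb R^{n\times n}$, $B_i\in\mathbb R^{n\times m_i}$, $G\in\mathbb R^{n\times p}$, $Q\succeq 0$, $R_1,R_2\succ 0$, and let $P\succeq0$ be the minimal positive semidefinite solution (assumed to exist) of $$A^{\top}P+PA+Q+P\,(B_2R_2^{-1}B_2^{\top}-B_1R_1^{-1}B_1^{\top})\,P=0 .$$ Put $\tilde A=A+B_2R_2^{-1}B_2^{\top}P$, $M_1=PB_1R_1^{-1}B_1^{\top}P$, $\Phi(t)=e^{\tilde At}$, and for a sampling step $h>0$ put $\tilde G^h=\int_0^h\Phi(s)GG^{\top}\Phi(s)^{\top}ds$. For $\Delta\in\mathbb N_0$, $\delta\in\{0,1\}$ and a multiplier $\lambda\ge0$ let $$U(\Delta)=\operatorname{tr}\Big(M_1\sum_{i=0}^{\Delta-1}\Phi(ih)\tilde G^h\Phi(ih)^{\top}\Big),\qquad \bar U(\Delta,\delta)=U(\Delta)+\lambda\delta .$$ Consider the Markov decision process with states (ages of information) $\Delta\in\mathbb N_0$, actions $\delta\in\{0,1\}$ ($1$ = sense), next state $\Delta'=1$ if $\delta=1$ and $\Delta'=\Delta+1$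 if $\delta=0$, and stage cost $\bar U$. Policies $\mu$ may be history-dependent and randomized. For initial age $\Delta$ let $$\bar J^h_{\beta,\lambda}(\Delta,\mu)=\mathbb E\Big[\sum_{k\ge0}\beta^k\bar U(\Delta_k,\delta_k)\Big],\quad V^h_{\beta,\lambda}(\Delta)=\inf_\mu \bar J^h_{\beta,\lambda}(\Delta,\mu),\quad \bar J^h_\lambda(\Delta,\mu)=\limsup_{m\to\infty}\frac1m\,\mathbb E\Big[\sum_{k=0}^m\bar U(\Delta_k,\delta_k)\Big],$$ where $\beta\in(0,1)$. A threshold $\eta\in\mathbb N_0\cup\{\infty\}$ is called $\beta$-optimal if the policy $\delta_k=\mathbb I[\Delta_k\ge\eta]$ attains $V^h_{\beta,\lambda}(\Delta)$ for every initial age $\Delta$ ($\eta=\infty$: never sense). **Theorem.** $V^h_{\beta,\lambda}(\Delta)<\infty$ for all $\beta\in(0,1)$ and $\Delta\in\mathbb N_0$, and the following hold. 1. There are $\bar V^h_\lambda\in\mathbb R$ and $f^h_\lambda:\mathbb N_0\to\mathbb R$ such that, for every $\Delta\in\mathbb N_0$, $$\bar V^h_\lambda=\lim_{\beta\nearrow1}(1-\beta)V^h_{\beta,\lambda}(\Delta),\qquad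 f^h_\lambda(\Delta)=\lim_{\beta\nearrow1}\big(V^h_{\beta,\lambda}(\Delta)-V^h_{\beta,\lambda}(1)\big),$$ (in particular the first limit does not depend on $\Delta$), and they satisfy the average-cost Bellman equation $$\bar V^h_\lambda+f^h_\lambda(\Delta)=\min_{\delta\in\{0,1\}}\big\{\bar U(\Delta,\delta)+f^h_\lambda(\Delta')\big\}\qquad\text{for all }\Delta\in\mathbb N_0 .$$ 2. For every $\beta\in(0,1)$ there is a $\beta$-optimal threshold. For every sequence $\beta_\ell\in(0,1)$ with $\beta_\ell\to1$ and every choice of $\beta_\ell$-optimal thresholds $\eta_\ell$, some subsequence of $(\eta_\ell)$ converges in $\mathbb N_0\cup\{\infty\}$ (equivalently, the corresponding policies converge pointwise in $\{0,1\}^{\mathbb N_0}$). 3. Let $\bar\eta_\lambda\in\mathbb N_0\cup\{\infty\}$ be any limit of $\beta_\ell$-optimal thresholds with $\beta_\ell\in(0,1)$, $\beta_\ell\to1$. Then the policy $\delta_k^*=\mathbb I[\Delta_k\ge\bar\eta_\lambda]$ is average-cost optimal: for every initial age its average cost equals $\bar V^h_\lambda$ and is at most that of any other policy. Moreover, for every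 $\Delta\in\mathbb N_0$, the action $\mathbb I[\Delta\ge\bar\eta_\lambda]$ attains the minimum in the Bellman equation. -/

import Mathlib

open Set Filter Topology MeasureTheory

/-- The matrices of the linear-quadratic zero-sum differential game
`dx = (A x + B₁ u₁ + B₂ u₂) dt + G dW` with running payoff
`‖x‖²_Q + ‖u₁‖²_{R₁} - ‖u₂‖²_{R₂}`. -/
structure LQGame (n m₁ m₂ p : ℕ) where
  A : Matrix (Fin n) (Fin n) ℝ
  B₁ : Matrix (Fin n) (Fin m₁) ℝ
  B₂ : Matrix (Fin n) (Fin m₂) ℝ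
  G : Matrix (Fin n) (Fin p) ℝ
  Q : Matrix (Fin n) (Fin n) ℝ
  R₁ : Matrix (Fin m₁) (Fin m₁) ℝ
  R₂ : Matrix (Fin m₂) (Fin m₂) ℝ

namespace LQGame

open scoped Matrix

variable {n m₁ m₂ p : ℕ} (S : LQGame n m₁ m₂ p) (P : Matrix (Fin n) (Fin n) ℝ)

/-- `P` is a positive semidefinite solution of the generalized algebraic Riccati equation. -/
def IsPSDSolution : Prop :=
  P.PosSemidef ∧
    S.Aᵀ * P + P * S.A + S.Q
      + P * (S.B₂ * S.R₂⁻¹ * S.B₂ᵀ - S.B₁ * S.R₁⁻¹ * S.B₁ᵀ) * P = 0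

/-- `P` is the minimal positive semidefinite solution (in the Loewner order). -/
def IsMinimalPSDSolution : Prop :=
  S.IsPSDSolution P ∧ ∀ P' : Matrix (Fin n) (Fin n) ℝ, S.IsPSDSolution P' → (P' - P).PosSemidef

/-- Closed-loop drift `Ã = A + B₂ R₂⁻¹ B₂ᵀ P`, when the maximizer plays `u₂ = R₂⁻¹ B₂ᵀ P x`. -/
noncomputable def Acl : Matrix (Fin n) (Fin n) ℝ := S.A + S.B₂ * S.R₂⁻¹ * S.B₂ᵀ * P

/-- Weight of the estimation error, `M₁ = P B₁ R₁⁻¹ B₁ᵀ P`. -/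
noncomputable def M₁ : Matrix (Fin n) (Fin n) ℝ := P * S.B₁ * S.R₁⁻¹ * S.B₁ᵀ * P

/-- Transition matrix `Φ(t) = exp (t Ã)`. -/
noncomputable def Phi (t : ℝ) : Matrix (Fin n) (Fin n) ℝ := NormedSpace.exp (t • S.Acl P)

/-- `G̃ʰ = ∫₀ʰ Φ(s) G Gᵀ Φ(s)ᵀ ds`, the integral being taken entrywise. -/
noncomputable def Gtilde (h : ℝ) : Matrix (Fin n) (Fin n) ℝ :=
  Matrix.of fun i j => ∫ s in (0 : ℝ)..h, (S.Phi P s * S.G * S.Gᵀ * (S.Phi P s)ᵀ) i j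

/-- Error cost at age `Δ`: `U(Δ) = tr (M₁ ∑_{i<Δ} Φ(ih) G̃ʰ Φ(ih)ᵀ)`. -/
noncomputable def U (h : ℝ) (Δ : ℕ) : ℝ :=
  Matrix.trace (S.M₁ P *
    ∑ i ∈ Finset.range Δ, S.Phi P (i * h) * S.Gtilde P h * (S.Phi P (i * h))ᵀ)

/-- Lagrangian stage cost `Ū(Δ, δ) = U(Δ) + λ δ`. -/
noncomputable def Ubar (h lam : ℝ) (Δ : ℕ) (δ : Bool) : ℝ :=
  S.U P h Δ + if δ then lam else 0

theorem continuous_Phi : Continuous (S.Phi P) := by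
  let _ : NormedRing (Matrix (Fin n) (Fin n) ℝ) := Matrix.linftyOpNormedRing
  let _ : NormedAlgebra ℝ (Matrix (Fin n) (Fin n) ℝ) := Matrix.linftyOpNormedAlgebra
  let _ : NormedAlgebra ℚ (Matrix (Fin n) (Fin n) ℝ) := NormedAlgebra.restrictScalars ℚ ℝ _
  have h : Continuous (NormedSpace.exp : Matrix (Fin n) (Fin n) ℝ → _) :=
    NormedSpace.exp_continuous
  exact h.comp (continuous_id.smul continuous_const)

theorem Gtilde_posSemidef {h : ℝ} (hh : 0 ≤ h) : (S.Gtilde P h).PosSemidef := by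
  set F : ℝ → Matrix (Fin n) (Fin n) ℝ := fun s => S.Phi P s * S.G * S.Gᵀ * (S.Phi P s)ᵀ with hF
  have hFp : ∀ s, (F s).PosSemidef := fun s => by
    have := Matrix.posSemidef_self_mul_conjTranspose (S.Phi P s * S.G)
    simpa [hF, Matrix.conjTranspose_eq_transpose_of_trivial, Matrix.mul_assoc] using this
  have hFc : Continuous F := by
    have h1 := S.continuous_Phi P
    exact ((h1.matrix_mul continuous_const).matrix_mul continuous_const).matrix_mul
      h1.matrix_transpose
  have hint : ∀ i j, IntervalIntegrable (fun s => F s i j) volume 0 h := fun i j =>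
    (hFc.matrix_elem i j).intervalIntegrable _ _
  refine Matrix.PosSemidef.of_dotProduct_mulVec_nonneg ?_ fun x => ?_
  · ext i j
    simp only [Gtilde, Matrix.conjTranspose_apply, Matrix.of_apply, star_trivial]
    refine intervalIntegral.integral_congr fun s _ => ?_
    simpa using (hFp s).isHermitian.apply i j
  · have key : star x ⬝ᵥ (S.Gtilde P h *ᵥ x)
        = ∫ s in (0 : ℝ)..h, star x ⬝ᵥ (F s *ᵥ x) := by
      simp only [dotProduct, Matrix.mulVec, Gtilde, Matrix.of_apply]
      rw [intervalIntegral.integral_finsetSum]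
      · refine Finset.sum_congr rfl fun i _ => ?_
        rw [intervalIntegral.integral_const_mul, intervalIntegral.integral_finsetSum]
        · simp [intervalIntegral.integral_mul_const, hF]
        · exact fun j _ => (hint i j).mul_const _
      · intro i _
        have hc : Continuous fun s => star x i * ∑ j, F s i j * x j :=
          continuous_const.mul (continuous_finsetSum _ fun j _ =>
            (hFc.matrix_elem i j).mul continuous_const)
        exact hc.intervalIntegrable _ _
    rw [key]
    exact intervalIntegral.integral_nonneg hh fun s _ => (hFp s).dotProduct_mulVec_nonneg x

/-- The error cost is nonnegative, so `ENNReal.ofReal` truncates nothing below. -/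
theorem U_nonneg {S : LQGame n m₁ m₂ p} {P : Matrix (Fin n) (Fin n) ℝ} (hR₁ : S.R₁.PosDef)
    (hP : P.PosSemidef) {h : ℝ} (hh : 0 ≤ h) (Δ : ℕ) : 0 ≤ S.U P h Δ := by
  have hX : (∑ i ∈ Finset.range Δ,
      S.Phi P (i * h) * S.Gtilde P h * (S.Phi P (i * h))ᵀ).PosSemidef := by
    refine Matrix.posSemidef_sum _ fun i _ => ?_
    have := (S.Gtilde_posSemidef P hh).mul_mul_conjTranspose_same (S.Phi P (i * h))
    simpa [Matrix.conjTranspose_eq_transpose_of_trivial] using this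
  have hM : (S.M₁ P).PosSemidef := by
    have := hR₁.posSemidef.inv.mul_mul_conjTranspose_same (P * S.B₁)
    have hPt : Pᵀ = P := by
      simpa [Matrix.conjTranspose_eq_transpose_of_trivial] using hP.isHermitian.eq
    simpa [M₁, Matrix.conjTranspose_eq_transpose_of_trivial, hPt, Matrix.mul_assoc] using this
  obtain ⟨D, hD⟩ : ∃ D : Matrix (Fin n) (Fin n) ℝ, S.M₁ P = Dᴴ * D := by
    open scoped MatrixOrder in
    exact CStarAlgebra.nonneg_iff_eq_star_mul_self.mp hM.nonneg
  rw [U, hD, Matrix.mul_assoc, Matrix.trace_mul_comm]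
  exact (hX.mul_mul_conjTranspose_same D).trace_nonneg

end LQGame

/-! ### The age-of-information decision process

States are ages `Δ ∈ ℕ`; the action `true` means "sense". -/

/-- Age dynamics: sensing resets the age to one, otherwise it grows by one. -/
def nextAge (Δ : ℕ) (δ : Bool) : ℕ := if δ then 1 else Δ + 1

/-- A (possibly randomized, history-dependent) sensor policy.  The filtered probability space
carries all information besides the ages (sensed states, past controls, private randomization);
at step `k` the action is a function of this information and of the ages `Δ₀, …, Δₖ`. -/
structure SensorPolicy where
  Ω : Type
  mΩ : MeasurableSpace Ω
  ℙ : Measure Ω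
  prob : IsProbabilityMeasure ℙ
  𝓕 : Filtration ℕ mΩ
  rule : (k : ℕ) → (Fin (k + 1) → ℕ) → Ω → Bool
  adapted : ∀ k H, Measurable[𝓕 k] (rule k H)

namespace SensorPolicy

variable (μ : SensorPolicy)

/-- The ages `Δ₀, …, Δₖ` generated by `μ` from the initial age `Δ`. -/
def ages (Δ : ℕ) (ω : μ.Ω) : (k : ℕ) → Fin (k + 1) → ℕ
  | 0 => fun _ => Δ
  | k + 1 => Fin.snoc (ages Δ ω k) (nextAge (ages Δ ω k (Fin.last k)) (μ.rule k (ages Δ ω k) ω))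

/-- The age `Δₖ`. -/
def age (Δ : ℕ) (k : ℕ) (ω : μ.Ω) : ℕ := μ.ages Δ ω k (Fin.last k)

/-- The action `δₖ`. -/
def action (Δ : ℕ) (k : ℕ) (ω : μ.Ω) : Bool := μ.rule k (μ.ages Δ ω k) ω

/-- Expected discounted cost `𝔼[∑_{k ≥ 0} βᵏ c(Δₖ, δₖ)]` of a nonnegative stage cost `c`. -/
noncomputable def discountedCost (c : ℕ → Bool → ℝ) (β : ℝ) (Δ : ℕ) : ENNReal :=
  letI := μ.mΩ
  ∫⁻ ω, ∑' k : ℕ, ENNReal.ofReal (β ^ k * c (μ.age Δ k ω) (μ.action Δ k ω)) ∂μ.ℙ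

/-- Long-run average cost `limsup_{m → ∞} (1/m) 𝔼[∑_{k=0}^m c(Δₖ, δₖ)]`. -/
noncomputable def averageCost (c : ℕ → Bool → ℝ) (Δ : ℕ) : ENNReal :=
  letI := μ.mΩ
  limsup (fun m : ℕ => (∫⁻ ω, ∑ k ∈ Finset.range (m + 1),
    ENNReal.ofReal (c (μ.age Δ k ω) (μ.action Δ k ω)) ∂μ.ℙ) / (m : ENNReal)) atTop

end SensorPolicy

/-- The threshold action `𝕀[Δ ≥ η]`, with `η = ⊤` meaning "never sense". -/
noncomputable def thresholdAction (η : ℕ∞) (Δ : ℕ) : Bool :=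
  open Classical in decide (η ≤ (Δ : ℕ∞))

/-- The stationary deterministic policy `δₖ = 𝕀[Δₖ ≥ η]`. -/
noncomputable def thresholdPolicy (η : ℕ∞) : SensorPolicy where
  Ω := Unit
  mΩ := inferInstance
  ℙ := Measure.dirac ()
  prob := inferInstance
  𝓕 := ⊥
  rule := fun k H _ => thresholdAction η (H (Fin.last k))
  adapted := fun _ _ => measurable_const

/-- The optimal discounted cost (value function) as a function of the initial age. -/
noncomputable def discountedValue (c : ℕ → Bool → ℝ) (β : ℝ) (Δ : ℕ) : ENNReal :=
  ⨅ μ : SensorPolicy, μ.discountedCost c β Δ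

/-- `η` is a `β`-optimal threshold: the threshold policy `η` attains the value function. -/
def IsDiscountOptimalThreshold (c : ℕ → Bool → ℝ) (β : ℝ) (η : ℕ∞) : Prop :=
  ∀ Δ : ℕ, (thresholdPolicy η).discountedCost c β Δ = discountedValue c β Δ

/-- `ηbar` is the limit of `β_ℓ`-optimal thresholds along some sequence of discount factors
`β_ℓ ∈ (0, 1)` converging to `1`.  Convergence in `ℕ∞` is pointwise convergence of the
corresponding policies in `{0,1}^ℕ`. -/
def IsLimitThreshold (c : ℕ → Bool → ℝ) (ηbar : ℕ∞) : Prop :=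
  ∃ (β : ℕ → ℝ) (η : ℕ → ℕ∞), (∀ ℓ, β ℓ ∈ Ioo (0 : ℝ) 1) ∧ Tendsto β atTop (𝓝 1) ∧
    (∀ ℓ, IsDiscountOptimalThreshold c (β ℓ) (η ℓ)) ∧ Tendsto η atTop (𝓝 ηbar)

/-! ### Monotonicity of the error cost -/

namespace LQGame

open scoped Matrix

variable {n m₁ m₂ p : ℕ} {S : LQGame n m₁ m₂ p} {P : Matrix (Fin n) (Fin n) ℝ}

/-! Beyond `U_nonneg`, all that is needed from the game is that `U` is nondecreasing; its growth is
unrestricted.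

Ages move deterministically, so for each outcome a policy is just an action sequence, and
randomization and memory cannot beat the infimum over sequences. That infimum is nondecreasing in
the age. In its Bellman equation the cost of sensing beyond `U Δ` is the same at every age, while
the cost of waiting increases; hence a threshold is optimal.

Write the equation in terms of `(1 - β) V(1)` and `V(Δ) - V(1)`. The remaining minimum lies in `[0,
lam]`, so both quantities are bounded for each age, and every ultrafilter tending to `1` from the
left yields a solution of the average-cost equation (`exists_ultrafilter_limit`). Such a solution is
unique (`gain_le`, `relativeValue_eq`), so the full limits exist.

For average optimality `f` may be unbounded above. The lower bound for all policies uses `f Δ ≤ U Δ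
+ lam - g`, the upper bound for a conserving rule uses `f 0 ≤ f Δ`. A limit threshold is conserving
because its action at each fixed age eventually agrees with discount-optimal ones. -/

theorem M₁_posSemidef (hR₁ : S.R₁.PosDef) (hP : P.PosSemidef) : (S.M₁ P).PosSemidef := by
  have := hR₁.posSemidef.inv.mul_mul_conjTranspose_same (P * S.B₁)
  have hPt : Pᵀ = P := by
    simpa [Matrix.conjTranspose_eq_transpose_of_trivial] using hP.isHermitian.eq
  simpa [M₁, Matrix.conjTranspose_eq_transpose_of_trivial, hPt, Matrix.mul_assoc] using this

/-- Each increment is the trace of a product of two positive semidefinite matrices; factoring `M₁ =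
Dᴴ D` turns it into `tr (D X Dᴴ) ≥ 0`. -/
theorem U_monotone (hR₁ : S.R₁.PosDef) (hP : P.PosSemidef) {h : ℝ} (hh : 0 ≤ h) :
    Monotone (S.U P h) := by
  refine monotone_nat_of_le_succ fun Δ => ?_
  have hX : (S.Phi P (Δ * h) * S.Gtilde P h * (S.Phi P (Δ * h))ᵀ).PosSemidef := by
    have := (S.Gtilde_posSemidef P hh).mul_mul_conjTranspose_same (S.Phi P (Δ * h))
    simpa [Matrix.conjTranspose_eq_transpose_of_trivial] using this
  obtain ⟨D, hD⟩ : ∃ D : Matrix (Fin n) (Fin n) ℝ, S.M₁ P = Dᴴ * D := by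
    open scoped MatrixOrder in
    exact CStarAlgebra.nonneg_iff_eq_star_mul_self.mp (M₁_posSemidef hR₁ hP).nonneg
  have hinc : 0 ≤ Matrix.trace
      (S.M₁ P * (S.Phi P (Δ * h) * S.Gtilde P h * (S.Phi P (Δ * h))ᵀ)) := by
    rw [hD, Matrix.mul_assoc, Matrix.trace_mul_comm]
    exact (hX.mul_mul_conjTranspose_same D).trace_nonneg
  rw [U, U, Finset.sum_range_succ, Matrix.mul_add, Matrix.trace_add]
  linarith

end LQGame

/-! ### Open-loop age paths and their discounted cost -/

/-- Stage cost made of an age penalty `U` and a price `lam` per sensing action. -/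
noncomputable def ageCost (U : ℕ → ℝ) (lam : ℝ) (Δ : ℕ) (δ : Bool) : ℝ :=
  U Δ + if δ then lam else 0

/-- The ages generated from `Δ` by a sequence of actions. -/
def agePath (Δ : ℕ) (a : ℕ → Bool) : ℕ → ℕ
  | 0 => Δ
  | k + 1 => nextAge (agePath Δ a k) (a k)

theorem agePath_succ_eq_tail (Δ : ℕ) (a : ℕ → Bool) (k : ℕ) :
    agePath Δ a (k + 1) = agePath (nextAge Δ (a 0)) (fun j => a (j + 1)) k := by
  induction k with
  | zero => rfl
  | succ k ih => rw [agePath, ih, agePath]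

theorem nextAge_mono {Δ Δ' : ℕ} (h : Δ ≤ Δ') (δ : Bool) : nextAge Δ δ ≤ nextAge Δ' δ := by
  cases δ <;> simp [nextAge, h]

/-- Coupling by the same actions; this is the source of the monotonicity of the value function. -/
theorem agePath_mono {Δ Δ' : ℕ} (h : Δ ≤ Δ') (a : ℕ → Bool) (k : ℕ) :
    agePath Δ a k ≤ agePath Δ' a k := by
  induction k with
  | zero => exact h
  | succ k ih => exact nextAge_mono ih _

/-- The actions produced from the initial age `Δ` by the stationary feedback rule `d`. -/
def closedLoop (d : ℕ → Bool) (Δ : ℕ) : ℕ → Bool :=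
  fun k => d ((fun s => nextAge s (d s))^[k] Δ)

theorem agePath_closedLoop (d : ℕ → Bool) (Δ k : ℕ) :
    agePath Δ (closedLoop d Δ) k = (fun s => nextAge s (d s))^[k] Δ := by
  induction k with
  | zero => rfl
  | succ k ih => rw [agePath, ih, Function.iterate_succ_apply']; rfl

theorem closedLoop_apply (d : ℕ → Bool) (Δ k : ℕ) :
    closedLoop d Δ k = d (agePath Δ (closedLoop d Δ) k) := by
  rw [agePath_closedLoop]; rfl

/-- Discounted cost of an action sequence. -/
noncomputable def pathCost (c : ℕ → Bool → ℝ) (β : ℝ) (Δ : ℕ) (a : ℕ → Bool) : ENNReal :=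
  ∑' k : ℕ, ENNReal.ofReal (β ^ k * c (agePath Δ a k) (a k))

/-- Least discounted cost over all action sequences. -/
noncomputable def optimalPathCost (c : ℕ → Bool → ℝ) (β : ℝ) (Δ : ℕ) : ENNReal :=
  ⨅ a : ℕ → Bool, pathCost c β Δ a

theorem pathCost_eq_add_tail (c : ℕ → Bool → ℝ) {β : ℝ} (hβ : 0 ≤ β) (Δ : ℕ) (a : ℕ → Bool) :
    pathCost c β Δ a = ENNReal.ofReal (c Δ (a 0)) +
      ENNReal.ofReal β * pathCost c β (nextAge Δ (a 0)) (fun j => a (j + 1)) := by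
  rw [pathCost, tsum_eq_zero_add' ENNReal.summable, pathCost, ← ENNReal.tsum_mul_left]
  congr 1
  · simp [agePath]
  · refine tsum_congr fun k => ?_
    rw [agePath_succ_eq_tail, ← ENNReal.ofReal_mul hβ, pow_succ]
    ring_nf

theorem optimalPathCost_le (c : ℕ → Bool → ℝ) {β : ℝ} (hβ : 0 < β) (Δ : ℕ) (δ : Bool) :
    optimalPathCost c β Δ ≤ ENNReal.ofReal (c Δ δ) +
      ENNReal.ofReal β * optimalPathCost c β (nextAge Δ δ) := by
  rw [optimalPathCost, optimalPathCost, ENNReal.mul_iInf_of_ne (by simpa using hβ)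
    ENNReal.ofReal_ne_top, ENNReal.add_iInf]
  -- The competitor plays `δ` first and then follows `a`.
  refine le_iInf fun a => (iInf_le _ (fun k => Nat.casesOn k δ a)).trans ?_
  exact (pathCost_eq_add_tail c hβ.le Δ _).le

/-- Only the first action has to be minimized over, and there are two of them; no optimal sequence
need exist. -/
theorem exists_le_optimalPathCost (c : ℕ → Bool → ℝ) {β : ℝ} (hβ : 0 ≤ β) (Δ : ℕ) :
    ∃ δ, ENNReal.ofReal (c Δ δ) + ENNReal.ofReal β * optimalPathCost c β (nextAge Δ δ)
      ≤ optimalPathCost c β Δ := by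
  obtain ⟨δ, hδ⟩ := Finite.exists_min fun δ : Bool =>
    ENNReal.ofReal (c Δ δ) + ENNReal.ofReal β * optimalPathCost c β (nextAge Δ δ)
  refine ⟨δ, le_iInf fun a => (hδ (a 0)).trans ?_⟩
  rw [pathCost_eq_add_tail c hβ]
  gcongr
  exact iInf_le _ _

theorem pathCost_closedLoop (c : ℕ → Bool → ℝ) {β : ℝ} (hβ : 0 ≤ β) (d : ℕ → Bool) (Δ : ℕ) :
    pathCost c β Δ (closedLoop d Δ) = ENNReal.ofReal (c Δ (d Δ)) +
      ENNReal.ofReal β * pathCost c β (nextAge Δ (d Δ)) (closedLoop d (nextAge Δ (d Δ))) :=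
  pathCost_eq_add_tail c hβ Δ _

/-- A feedback rule that is conserving for `v` costs at most `v`. -/
theorem pathCost_closedLoop_le {c : ℕ → Bool → ℝ} {β : ℝ} (hβ : 0 ≤ β) {d : ℕ → Bool}
    {v : ℕ → ENNReal}
    (hv : ∀ Δ, ENNReal.ofReal (c Δ (d Δ)) + ENNReal.ofReal β * v (nextAge Δ (d Δ)) ≤ v Δ)
    (Δ : ℕ) : pathCost c β Δ (closedLoop d Δ) ≤ v Δ := by
  set a := closedLoop d Δ with ha
  -- Cost paid so far plus discounted residual value never exceeds `v Δ`. The residual is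
  -- nonnegative and can be dropped, so no transversality condition is needed.
  have key : ∀ m, ∑ k ∈ Finset.range m, ENNReal.ofReal (β ^ k * c (agePath Δ a k) (a k))
      + ENNReal.ofReal (β ^ m) * v (agePath Δ a m) ≤ v Δ := by
    intro m
    induction m with
    | zero => simp [agePath]
    | succ m ih =>
      refine le_trans ?_ ih
      rw [Finset.sum_range_succ, add_assoc]
      gcongr
      have hstep := hv (agePath Δ a m)
      rw [← closedLoop_apply d Δ m, ← ha] at hstep
      calc _ = ENNReal.ofReal (β ^ m) * (ENNReal.ofReal (c (agePath Δ a m) (a m)) +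
            ENNReal.ofReal β * v (nextAge (agePath Δ a m) (a m))) := by
            rw [mul_add, ENNReal.ofReal_mul (pow_nonneg hβ m), pow_succ,
              ENNReal.ofReal_mul (pow_nonneg hβ m), mul_assoc, agePath]
        _ ≤ _ := by gcongr
  exact ENNReal.tsum_le_of_sum_range_le fun m => le_self_add.trans (key m)

/-! ### Policies -/

namespace SensorPolicy

variable (μ : SensorPolicy)

theorem age_eq_agePath (Δ k : ℕ) (ω : μ.Ω) :
    μ.age Δ k ω = agePath Δ (fun j => μ.action Δ j ω) k := by
  induction k with
  | zero => rfl
  | succ k ih =>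
    rw [agePath, ← ih, age, ages, Fin.snoc_last]
    rfl

/-- The bound holds for each outcome separately and is then integrated against a probability
measure. -/
theorem optimalPathCost_le_discountedCost (c : ℕ → Bool → ℝ) (β : ℝ) (Δ : ℕ) :
    optimalPathCost c β Δ ≤ μ.discountedCost c β Δ := by
  let _ := μ.mΩ
  have := μ.prob
  calc optimalPathCost c β Δ = ∫⁻ _, optimalPathCost c β Δ ∂μ.ℙ := by simp
    _ ≤ μ.discountedCost c β Δ := by
      refine lintegral_mono fun ω => (iInf_le _ (fun j => μ.action Δ j ω)).trans_eq ?_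
      simp only [pathCost, age_eq_agePath]

end SensorPolicy

theorem thresholdPolicy_age_action (η : ℕ∞) (Δ k : ℕ) (ω : (thresholdPolicy η).Ω) :
    (thresholdPolicy η).age Δ k ω = agePath Δ (closedLoop (thresholdAction η) Δ) k ∧
      (thresholdPolicy η).action Δ k ω = closedLoop (thresholdAction η) Δ k := by
  have hact : ∀ k, (thresholdPolicy η).action Δ k ω
      = thresholdAction η ((thresholdPolicy η).age Δ k ω) := fun _ => rfl
  have hage : ∀ k, (thresholdPolicy η).age Δ k ω
      = agePath Δ (closedLoop (thresholdAction η) Δ) k := by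
    intro k
    induction k with
    | zero => rfl
    | succ k ih =>
      rw [SensorPolicy.age_eq_agePath, agePath, ← SensorPolicy.age_eq_agePath, hact, ih, agePath,
        ← closedLoop_apply (thresholdAction η) Δ k]
  exact ⟨hage k, by rw [hact, hage, ← closedLoop_apply (thresholdAction η) Δ k]⟩

theorem thresholdPolicy_discountedCost (c : ℕ → Bool → ℝ) (β : ℝ) (η : ℕ∞) (Δ : ℕ) :
    (thresholdPolicy η).discountedCost c β Δ
      = pathCost c β Δ (closedLoop (thresholdAction η) Δ) := by
  let _ := (thresholdPolicy η).mΩ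
  have := (thresholdPolicy η).prob
  simp only [SensorPolicy.discountedCost, thresholdPolicy_age_action, lintegral_const,
    measure_univ, mul_one, pathCost]

theorem optimalPathCost_le_discountedValue (c : ℕ → Bool → ℝ) (β : ℝ) (Δ : ℕ) :
    optimalPathCost c β Δ ≤ discountedValue c β Δ :=
  le_iInf fun μ => μ.optimalPathCost_le_discountedCost c β Δ

theorem discountedValue_le_thresholdPolicy (c : ℕ → Bool → ℝ) (β : ℝ) (η : ℕ∞) (Δ : ℕ) :
    discountedValue c β Δ ≤ pathCost c β Δ (closedLoop (thresholdAction η) Δ) :=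
  (iInf_le _ (thresholdPolicy η)).trans_eq (thresholdPolicy_discountedCost c β η Δ)

theorem exists_thresholdAction_iff {p : ℕ → Prop} (hp : ∀ ⦃i j⦄, i ≤ j → p i → p j) :
    ∃ η : ℕ∞, ∀ Δ : ℕ, thresholdAction η Δ = true ↔ p Δ := by
  classical
  by_cases h : ∃ k, p k
  · refine ⟨(Nat.find h : ℕ), fun Δ => ?_⟩
    simp only [thresholdAction, decide_eq_true_eq, Nat.cast_le]
    exact ⟨fun hle => hp hle (Nat.find_spec h), fun hΔ => Nat.find_min' h hΔ⟩
  · refine ⟨⊤, fun Δ => ?_⟩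
    simp only [thresholdAction, decide_eq_true_eq, top_le_iff, ENat.natCast_ne_top, false_iff]
    exact fun hΔ => h ⟨Δ, hΔ⟩

/-! ### The discounted problem for a monotone age penalty -/

section Discounted

variable {U : ℕ → ℝ} {lam β : ℝ}

theorem ageCost_nonneg (hU : ∀ Δ, 0 ≤ U Δ) (hlam : 0 ≤ lam) (Δ : ℕ) (δ : Bool) :
    0 ≤ ageCost U lam Δ δ := by
  cases δ <;> simp [ageCost, hU Δ, add_nonneg (hU Δ) hlam]

theorem optimalPathCost_monotone (hmono : Monotone U) (hβ : 0 ≤ β) :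
    Monotone (optimalPathCost (ageCost U lam) β) := fun _ _ h =>
  iInf_mono fun a => ENNReal.tsum_le_tsum fun k => ENNReal.ofReal_le_ofReal <|
    mul_le_mul_of_nonneg_left (add_le_add_left (hmono (agePath_mono h a k)) _)
      (pow_nonneg hβ k)

/-- Sensing at every step keeps the age at one, so the cost is a geometric series however fast `U`
grows. -/
theorem optimalPathCost_one_lt_top (hU : ∀ Δ, 0 ≤ U Δ) (hlam : 0 ≤ lam) (hβ : β ∈ Ioo (0 : ℝ) 1) :
    optimalPathCost (ageCost U lam) β 1 < ⊤ := by
  have hpath : ∀ k, agePath 1 (fun _ => true) k = 1 := by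
    intro k; cases k <;> rfl
  refine (iInf_le _ (fun _ => true)).trans_lt ?_
  have hsum : Summable fun k : ℕ => β ^ k * ageCost U lam 1 true :=
    (summable_geometric_of_lt_one hβ.1.le hβ.2).mul_right _
  simp only [pathCost, hpath]
  rw [← ENNReal.ofReal_tsum_of_nonneg
    (fun k => mul_nonneg (pow_nonneg hβ.1.le k) (ageCost_nonneg hU hlam _ _)) hsum]
  exact ENNReal.ofReal_lt_top

theorem optimalPathCost_lt_top (hU : ∀ Δ, 0 ≤ U Δ) (hlam : 0 ≤ lam) (hβ : β ∈ Ioo (0 : ℝ) 1)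
    (Δ : ℕ) : optimalPathCost (ageCost U lam) β Δ < ⊤ :=
  (optimalPathCost_le _ hβ.1 Δ true).trans_lt <| ENNReal.add_lt_top.2 ⟨ENNReal.ofReal_lt_top,
    ENNReal.mul_lt_top ENNReal.ofReal_lt_top (optimalPathCost_one_lt_top hU hlam hβ)⟩

theorem toReal_optimalPathCost_bellman (hU : ∀ Δ, 0 ≤ U Δ) (hlam : 0 ≤ lam)
    (hβ : β ∈ Ioo (0 : ℝ) 1) (Δ : ℕ) :
    (optimalPathCost (ageCost U lam) β Δ).toReal = U Δ +
      min (lam + β * (optimalPathCost (ageCost U lam) β 1).toReal)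
        (β * (optimalPathCost (ageCost U lam) β (Δ + 1)).toReal) := by
  set c := ageCost U lam with hc
  have hfin := optimalPathCost_lt_top hU hlam hβ
  have hreal : ∀ δ, (ENNReal.ofReal (c Δ δ) +
      ENNReal.ofReal β * optimalPathCost c β (nextAge Δ δ)).toReal
        = c Δ δ + β * (optimalPathCost c β (nextAge Δ δ)).toReal := fun δ => by
    rw [ENNReal.toReal_add ENNReal.ofReal_ne_top
      (ENNReal.mul_ne_top ENNReal.ofReal_ne_top (hfin _).ne), ENNReal.toReal_mul,
      ENNReal.toReal_ofReal (ageCost_nonneg hU hlam _ _), ENNReal.toReal_ofReal hβ.1.le]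
  have hle : ∀ δ, (optimalPathCost c β Δ).toReal
      ≤ c Δ δ + β * (optimalPathCost c β (nextAge Δ δ)).toReal := fun δ => by
    rw [← hreal]
    exact ENNReal.toReal_mono (ENNReal.add_ne_top.2 ⟨ENNReal.ofReal_ne_top,
      ENNReal.mul_ne_top ENNReal.ofReal_ne_top (hfin _).ne⟩) (optimalPathCost_le c hβ.1 Δ δ)
  obtain ⟨δ, hδ⟩ := exists_le_optimalPathCost c hβ.1.le Δ
  have hge := ENNReal.toReal_mono (hfin Δ).ne hδ
  rw [hreal] at hge
  have hf := hle false
  have ht := hle true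
  simp only [hc, ageCost, nextAge, if_true, Bool.false_eq_true, if_false] at hf ht
  rw [← min_add_add_left]
  refine le_antisymm (le_min (by linarith) (by linarith)) ?_
  cases δ
  · simp only [hc, ageCost, nextAge, Bool.false_eq_true, if_false] at hge
    exact (min_le_right _ _).trans (by linarith)
  · simp only [hc, ageCost, nextAge, if_true] at hge
    exact (min_le_left _ _).trans (by linarith)

/-- The ages at which sensing is no worse than waiting form an upward closed set, because only the
waiting branch depends on the successor age `Δ + 1`. -/
theorem exists_threshold_pathCost_le (hU : ∀ Δ, 0 ≤ U Δ) (hmono : Monotone U) (hlam : 0 ≤ lam)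
    (hβ : β ∈ Ioo (0 : ℝ) 1) :
    ∃ η : ℕ∞, ∀ Δ, pathCost (ageCost U lam) β Δ (closedLoop (thresholdAction η) Δ)
      ≤ optimalPathCost (ageCost U lam) β Δ := by
  set w := optimalPathCost (ageCost U lam) β with hw
  have hfin : ∀ Δ, w Δ < ⊤ := optimalPathCost_lt_top hU hlam hβ
  have hwm : Monotone w := optimalPathCost_monotone hmono hβ.1.le
  obtain ⟨η, hη⟩ := exists_thresholdAction_iff
    (p := fun Δ => lam + β * (w 1).toReal ≤ β * (w (Δ + 1)).toReal)
    fun i j hij hi => hi.trans (mul_le_mul_of_nonneg_left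
      (ENNReal.toReal_mono (hfin _).ne (hwm (by omega))) hβ.1.le)
  refine ⟨η, pathCost_closedLoop_le hβ.1.le fun Δ => ?_⟩
  have hb := toReal_optimalPathCost_bellman hU hlam hβ Δ
  rw [← hw] at hb
  rw [← ENNReal.ofReal_toReal (hfin Δ).ne, ← ENNReal.ofReal_toReal (hfin (nextAge Δ _)).ne,
    ← ENNReal.ofReal_mul hβ.1.le, ← ENNReal.ofReal_add (ageCost_nonneg hU hlam _ _)
      (mul_nonneg hβ.1.le ENNReal.toReal_nonneg)]
  refine ENNReal.ofReal_le_ofReal ?_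
  rw [hb]
  by_cases hΔ : thresholdAction η Δ = true
  · rw [min_eq_left ((hη Δ).1 hΔ), hΔ]
    simp only [ageCost, nextAge, if_true]
    linarith
  · rw [min_eq_right (le_of_not_ge fun h => hΔ ((hη Δ).2 h)), Bool.eq_false_of_not_eq_true hΔ]
    simp [ageCost, nextAge]

theorem discountedValue_eq_optimalPathCost (hU : ∀ Δ, 0 ≤ U Δ) (hmono : Monotone U)
    (hlam : 0 ≤ lam) (hβ : β ∈ Ioo (0 : ℝ) 1) :
    discountedValue (ageCost U lam) β = optimalPathCost (ageCost U lam) β := by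
  obtain ⟨η, hη⟩ := exists_threshold_pathCost_le hU hmono hlam hβ
  funext Δ
  exact le_antisymm ((discountedValue_le_thresholdPolicy _ β η Δ).trans (hη Δ))
    (optimalPathCost_le_discountedValue _ β Δ)

theorem exists_isDiscountOptimalThreshold (hU : ∀ Δ, 0 ≤ U Δ) (hmono : Monotone U)
    (hlam : 0 ≤ lam) (hβ : β ∈ Ioo (0 : ℝ) 1) :
    ∃ η, IsDiscountOptimalThreshold (ageCost U lam) β η := by
  obtain ⟨η, hη⟩ := exists_threshold_pathCost_le hU hmono hlam hβ
  refine ⟨η, fun Δ => ?_⟩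
  rw [thresholdPolicy_discountedCost, discountedValue_eq_optimalPathCost hU hmono hlam hβ]
  exact le_antisymm (hη Δ) (iInf_le _ _)

/-- Optimality from every initial age, the successor included, makes any optimal threshold
conserving, not just the one constructed above. -/
theorem IsDiscountOptimalThreshold.value_eq (hU : ∀ Δ, 0 ≤ U Δ) (hmono : Monotone U)
    (hlam : 0 ≤ lam) (hβ : β ∈ Ioo (0 : ℝ) 1) {η : ℕ∞}
    (hη : IsDiscountOptimalThreshold (ageCost U lam) β η) (Δ : ℕ) :
    (discountedValue (ageCost U lam) β Δ).toReal = ageCost U lam Δ (thresholdAction η Δ) +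
      β * (discountedValue (ageCost U lam) β (nextAge Δ (thresholdAction η Δ))).toReal := by
  have hfin := optimalPathCost_lt_top hU hlam hβ (nextAge Δ (thresholdAction η Δ))
  rw [← discountedValue_eq_optimalPathCost hU hmono hlam hβ] at hfin
  rw [← hη Δ, thresholdPolicy_discountedCost, pathCost_closedLoop _ hβ.1.le,
    ← thresholdPolicy_discountedCost, hη, ENNReal.toReal_add ENNReal.ofReal_ne_top
      (ENNReal.mul_ne_top ENNReal.ofReal_ne_top hfin.ne), ENNReal.toReal_mul,
    ENNReal.toReal_ofReal (ageCost_nonneg hU hlam _ _), ENNReal.toReal_ofReal hβ.1.le]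

end Discounted

/-! ### The average-cost equation -/

/-- `(g, f)` solves the average-cost Bellman equation of `ageCost U lam`, with `f` nondecreasing
and normalized by `f 1 = 0`. -/
structure SolvesAverageEquation (U : ℕ → ℝ) (lam g : ℝ) (f : ℕ → ℝ) : Prop where
  eqn : ∀ Δ, g + f Δ = U Δ + min lam (f (Δ + 1))
  one : f 1 = 0
  mono : Monotone f

namespace SolvesAverageEquation

variable {U : ℕ → ℝ} {lam g g' : ℝ} {f f' : ℕ → ℝ}

theorem eq_min (hs : SolvesAverageEquation U lam g f) (Δ : ℕ) :
    g + f Δ = min (ageCost U lam Δ false + f (nextAge Δ false))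
      (ageCost U lam Δ true + f (nextAge Δ true)) := by
  simp only [ageCost, nextAge, if_true, Bool.false_eq_true, if_false, hs.one, add_zero]
  rw [hs.eqn, min_comm, min_add_add_left]

theorem le_step (hs : SolvesAverageEquation U lam g f) (Δ : ℕ) (δ : Bool) :
    g + f Δ ≤ ageCost U lam Δ δ + f (nextAge Δ δ) := by
  rw [hs.eq_min]
  cases δ
  · exact min_le_left _ _
  · exact min_le_right _ _

theorem le_sum_ageCost (hs : SolvesAverageEquation U lam g f) (a : ℕ → Bool) (Δ m : ℕ) :
    m * g + f Δ - f (agePath Δ a m)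
      ≤ ∑ k ∈ Finset.range m, ageCost U lam (agePath Δ a k) (a k) := by
  induction m with
  | zero => simp [agePath]
  | succ m ih =>
    have := hs.le_step (agePath Δ a m) (a m)
    rw [Finset.sum_range_succ, agePath]
    push_cast
    linarith

/-- The terminal relative value is absorbed by the last stage cost, uniformly in the path. -/
theorem le_sum_ageCost_succ (hs : SolvesAverageEquation U lam g f) (hlam : 0 ≤ lam)
    (a : ℕ → Bool) (Δ m : ℕ) :
    (m + 1) * g + f Δ - lam
      ≤ ∑ k ∈ Finset.range (m + 1), ageCost U lam (agePath Δ a k) (a k) := by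
  have h1 := hs.le_sum_ageCost a Δ m
  -- The equation at the last age gives `f ≤ U + lam - g` there.
  have h2 := hs.eqn (agePath Δ a m)
  have h3 := min_le_left lam (f (agePath Δ a m + 1))
  have h4 : U (agePath Δ a m) ≤ ageCost U lam (agePath Δ a m) (a m) := by
    rw [ageCost]; split_ifs <;> linarith
  rw [Finset.sum_range_succ]
  linarith

theorem sum_ageCost_closedLoop {d : ℕ → Bool}
    (hd : ∀ Δ, g + f Δ = ageCost U lam Δ (d Δ) + f (nextAge Δ (d Δ))) (Δ m : ℕ) :
    ∑ k ∈ Finset.range m, ageCost U lam (agePath Δ (closedLoop d Δ) k) (closedLoop d Δ k)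
      = m * g + f Δ - f (agePath Δ (closedLoop d Δ) m) := by
  induction m with
  | zero => simp [agePath]
  | succ m ih =>
    have := hd (agePath Δ (closedLoop d Δ) m)
    rw [← closedLoop_apply d Δ m] at this
    rw [Finset.sum_range_succ, agePath, ih]
    push_cast
    linarith

theorem sum_ageCost_closedLoop_le (hs : SolvesAverageEquation U lam g f) {d : ℕ → Bool}
    (hd : ∀ Δ, g + f Δ = ageCost U lam Δ (d Δ) + f (nextAge Δ (d Δ))) (Δ m : ℕ) :
    ∑ k ∈ Finset.range (m + 1), ageCost U lam (agePath Δ (closedLoop d Δ) k) (closedLoop d Δ k)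
      ≤ (m + 1) * g + (f Δ - f 0) := by
  rw [sum_ageCost_closedLoop hd]
  -- The terminal value enters with a minus sign, so the lower bound `f 0` suffices.
  have := hs.mono (Nat.zero_le (agePath Δ (closedLoop d Δ) (m + 1)))
  push_cast
  linarith

theorem exists_conserving (hs : SolvesAverageEquation U lam g f) :
    ∃ d : ℕ → Bool, ∀ Δ, g + f Δ = ageCost U lam Δ (d Δ) + f (nextAge Δ (d Δ)) := by
  have : ∀ Δ, ∃ δ, g + f Δ = ageCost U lam Δ δ + f (nextAge Δ δ) := fun Δ => by
    rcases min_choice (ageCost U lam Δ false + f (nextAge Δ false))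
      (ageCost U lam Δ true + f (nextAge Δ true)) with h | h
    · exact ⟨false, (hs.eq_min Δ).trans h⟩
    · exact ⟨true, (hs.eq_min Δ).trans h⟩
  choose d hd using this
  exact ⟨d, hd⟩

/-- A conserving path for `(g, f)` costs at most `(m + 1) g + O(1)`, while `(g', f')` bounds every
path below by `(m + 1) g' - O(1)`. -/
theorem gain_le (hs : SolvesAverageEquation U lam g f) (hs' : SolvesAverageEquation U lam g' f')
    (hlam : 0 ≤ lam) : g' ≤ g := by
  obtain ⟨d, hd⟩ := hs.exists_conserving
  by_contra! hlt
  obtain ⟨m, hm⟩ := exists_nat_gt ((lam - f 0) / (g' - g))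
  rw [div_lt_iff₀ (sub_pos.2 hlt)] at hm
  have h1 := hs.sum_ageCost_closedLoop_le hd 1 m
  have h2 := hs'.le_sum_ageCost_succ hlam (closedLoop d 1) 1 m
  rw [hs.one] at h1
  rw [hs'.one] at h2
  nlinarith

/-- Where continuing is strictly penalized, sensing is optimal. -/
theorem min_eq_of_lt (hs : SolvesAverageEquation U lam g f) {Δ : ℕ} (hΔ : g < U (Δ + 1)) :
    min lam (f (Δ + 1)) = lam := by
  refine min_eq_left ?_
  by_contra! hlt
  -- If `f (Δ + 1) < lam`, monotonicity gives `f (Δ + 1) ≤ min lam (f (Δ + 2))`, but the equation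
  -- and `g < U (Δ + 1)` give the reverse strict inequality.
  have h1 := hs.eqn (Δ + 1)
  have h2 := hs.mono (Nat.le_succ (Δ + 1))
  rcases min_choice lam (f (Δ + 1 + 1)) with h | h <;> rw [h] at h1 <;>
    simp only [Nat.succ_eq_add_one] at h2 <;> linarith

/-- The truncated values `min lam (f (Δ + 1))` determine `f`. If `U` exceeds `g` at some positive
age, they equal `lam` from there on and the equation propagates them backward. Otherwise `f ≤ lam`
at all positive ages, and the equation is a forward recursion from `f 1 = 0`. -/
theorem relativeValue_eq (hs : SolvesAverageEquation U lam g f)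
    (hs' : SolvesAverageEquation U lam g f') (hmono : Monotone U) : f = f' := by
  suffices h : ∀ Δ, min lam (f (Δ + 1)) = min lam (f' (Δ + 1)) by
    funext Δ
    have := hs.eqn Δ
    have := hs'.eqn Δ
    have := h Δ
    linarith
  by_cases hex : ∃ N, g < U (N + 1)
  · obtain ⟨N, hN⟩ := hex
    have hlarge : ∀ j, min lam (f (N + j + 1)) = min lam (f' (N + j + 1)) := fun j => by
      have hj : g < U (N + j + 1) := hN.trans_le (hmono (by omega))
      rw [hs.min_eq_of_lt hj, hs'.min_eq_of_lt hj]
    have hback : ∀ i Δ, Δ + i = N → min lam (f (Δ + 1)) = min lam (f' (Δ + 1)) := by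
      intro i
      induction i with
      | zero => intro Δ h; obtain rfl : Δ = N := h; exact hlarge 0
      | succ i ih =>
        intro Δ h
        have h1 := hs.eqn (Δ + 1)
        have h2 := hs'.eqn (Δ + 1)
        have h3 := ih (Δ + 1) (by omega)
        rw [show f (Δ + 1) = f' (Δ + 1) by linarith]
    intro Δ
    rcases le_total Δ N with h | h
    · exact hback (N - Δ) Δ (by omega)
    · obtain ⟨j, rfl⟩ := Nat.exists_eq_add_of_le h
      exact hlarge j
  · push Not at hex
    have hstep : ∀ {f : ℕ → ℝ}, SolvesAverageEquation U lam g f → ∀ Δ,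
        min lam (f (Δ + 1)) = U (Δ + 1) - g + min lam (f (Δ + 1 + 1)) := by
      intro f hs Δ
      have h1 := hs.eqn (Δ + 1)
      have h2 := hex Δ
      have h3 := min_le_left lam (f (Δ + 1 + 1))
      rw [min_eq_right (by linarith : f (Δ + 1) ≤ lam)]
      linarith
    intro Δ
    induction Δ with
    | zero => rw [zero_add, hs.one, hs'.one]
    | succ Δ ih =>
      have h1 := hstep hs Δ
      have h2 := hstep hs' Δ
      linarith

end SolvesAverageEquation

/-! ### The vanishing-discount limit -/

theorem Ultrafilter.exists_tendsto_of_eventually_mem_Icc {α : Type*} (u : Ultrafilter α)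
    {φ : α → ℝ} {a b : ℝ} (h : ∀ᶠ x in (u : Filter α), φ x ∈ Icc a b) :
    ∃ y, Tendsto φ u (𝓝 y) := by
  obtain ⟨y, -, hy⟩ := (isCompact_Icc (a := a) (b := b)).ultrafilter_le_nhds (u.map φ)
    (le_principal_iff.2 h)
  exact ⟨y, hy⟩

section VanishingDiscount

variable {U : ℕ → ℝ} {lam : ℝ} {V : ℝ → ℕ → ℝ}

theorem bellman_sub_normalized {β : ℝ} {v : ℕ → ℝ}
    (hv : ∀ Δ, v Δ = U Δ + min (lam + β * v 1) (β * v (Δ + 1))) (Δ : ℕ) :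
    (1 - β) * v 1 + (v Δ - v 1) = U Δ + min lam (β * (v (Δ + 1) - v 1)) := by
  have h : min (lam + β * v 1) (β * v (Δ + 1))
      = min lam (β * (v (Δ + 1) - v 1)) + β * v 1 := by
    rw [← min_add_add_right]; ring_nf
  have := hv Δ
  rw [h] at this
  linarith

/-- An ultrafilter makes all ages converge at once, with no diagonal extraction. -/
theorem exists_ultrafilter_limit (hlam : 0 ≤ lam)
    (hV : ∀ β ∈ Ioo (0 : ℝ) 1, ∀ Δ,
      V β Δ = U Δ + min (lam + β * V β 1) (β * V β (Δ + 1)))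
    (hVm : ∀ β ∈ Ioo (0 : ℝ) 1, Monotone (V β))
    (u : Ultrafilter ℝ) (hu : (u : Filter ℝ) ≤ 𝓝[<] 1) :
    ∃ g f, SolvesAverageEquation U lam g f ∧ Tendsto (fun β => (1 - β) * V β 1) u (𝓝 g) ∧
      ∀ Δ, Tendsto (fun β => V β Δ - V β 1) u (𝓝 (f Δ)) := by
  have hev : ∀ᶠ β in (u : Filter ℝ), β ∈ Ioo (0 : ℝ) 1 :=
    hu (Ioo_mem_nhdsLT zero_lt_one)
  have hβ : Tendsto (fun β : ℝ => β) u (𝓝 1) := hu.trans nhdsWithin_le_nhds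
  have hrel : ∀ β ∈ Ioo (0 : ℝ) 1, ∀ Δ, (1 - β) * V β 1 + (V β Δ - V β 1)
      = U Δ + min lam (β * (V β (Δ + 1) - V β 1)) := fun β h => bellman_sub_normalized (hV β h)
  have hnn : ∀ β ∈ Ioo (0 : ℝ) 1, ∀ Δ, 0 ≤ min lam (β * (V β (Δ + 1) - V β 1)) :=
    fun β h Δ => le_min hlam (mul_nonneg h.1.le (sub_nonneg.2 (hVm β h (by omega))))
  -- At age one the relative value vanishes, leaving `U 1` plus a minimum in `[0, lam]`.
  have hgain : ∀ β ∈ Ioo (0 : ℝ) 1, (1 - β) * V β 1 ∈ Icc (U 1) (U 1 + lam) := fun β h => by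
    have h1 := hrel β h 1
    have h2 := hnn β h 1
    have h3 := min_le_left lam (β * (V β (1 + 1) - V β 1))
    constructor <;> linarith
  obtain ⟨g, hg⟩ := u.exists_tendsto_of_eventually_mem_Icc (hev.mono hgain)
  have hbdd : ∀ Δ, ∃ y, Tendsto (fun β => V β Δ - V β 1) u (𝓝 y) := fun Δ => by
    refine u.exists_tendsto_of_eventually_mem_Icc (a := U Δ - (U 1 + lam))
      (b := U Δ + lam - U 1) (hev.mono fun β h => ?_)
    have h1 := hrel β h Δ
    have h2 := hnn β h Δ
    have h3 := min_le_left lam (β * (V β (Δ + 1) - V β 1))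
    have h4 := hgain β h
    constructor <;> linarith [h4.1, h4.2]
  choose f hf using hbdd
  refine ⟨g, f, ⟨fun Δ => ?_, ?_, fun i j hij => ?_⟩, hg, hf⟩
  · have hright : Tendsto (fun β => U Δ + min lam (β * (V β (Δ + 1) - V β 1))) u
        (𝓝 (U Δ + min lam (1 * f (Δ + 1)))) :=
      (tendsto_const_nhds.min (hβ.mul (hf (Δ + 1)))).const_add _
    rw [one_mul] at hright
    exact tendsto_nhds_unique ((hg.add (hf Δ)).congr' (hev.mono fun β h => hrel β h Δ)) hright
  · exact tendsto_nhds_unique (hf 1) (by simp)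
  · exact le_of_tendsto_of_tendsto (hf i) (hf j)
      (hev.mono fun β h => sub_le_sub_right (hVm β h hij) _)

theorem exists_vanishing_discount_limit (hlam : 0 ≤ lam) (hmono : Monotone U)
    (hV : ∀ β ∈ Ioo (0 : ℝ) 1, ∀ Δ,
      V β Δ = U Δ + min (lam + β * V β 1) (β * V β (Δ + 1)))
    (hVm : ∀ β ∈ Ioo (0 : ℝ) 1, Monotone (V β)) :
    ∃ g f, SolvesAverageEquation U lam g f ∧
      (∀ Δ, Tendsto (fun β => (1 - β) * V β Δ) (𝓝[<] 1) (𝓝 g)) ∧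
      ∀ Δ, Tendsto (fun β => V β Δ - V β 1) (𝓝[<] 1) (𝓝 (f Δ)) := by
  have hlim := exists_ultrafilter_limit hlam hV hVm
  obtain ⟨g, f, hs, -, -⟩ := hlim (Ultrafilter.of (𝓝[<] 1)) (Ultrafilter.of_le _)
  have huniq : ∀ u : Ultrafilter ℝ, (u : Filter ℝ) ≤ 𝓝[<] 1 →
      Tendsto (fun β => (1 - β) * V β 1) u (𝓝 g) ∧
        ∀ Δ, Tendsto (fun β => V β Δ - V β 1) u (𝓝 (f Δ)) := fun u hu => by
    obtain ⟨g', f', hs', hg', hf'⟩ := hlim u hu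
    obtain rfl : g = g' := le_antisymm (hs'.gain_le hs hlam) (hs.gain_le hs' hlam)
    obtain rfl : f = f' := hs.relativeValue_eq hs' hmono
    exact ⟨hg', hf'⟩
  have hf : ∀ Δ, Tendsto (fun β => V β Δ - V β 1) (𝓝[<] 1) (𝓝 (f Δ)) := fun Δ =>
    (tendsto_iff_ultrafilter _ _ _).2 fun u hu => (huniq u hu).2 Δ
  have hg : Tendsto (fun β => (1 - β) * V β 1) (𝓝[<] 1) (𝓝 g) :=
    (tendsto_iff_ultrafilter _ _ _).2 fun u hu => (huniq u hu).1
  refine ⟨g, f, hs, fun Δ => ?_, hf⟩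
  -- Changing the initial age adds `(1 - β) (V β Δ - V β 1)`, which tends to `0`.
  have hone : Tendsto (fun β : ℝ => 1 - β) (𝓝[<] 1) (𝓝 (1 - 1)) :=
    (tendsto_id.mono_left nhdsWithin_le_nhds).const_sub 1
  have := hg.add (hone.mul (hf Δ))
  rw [sub_self, zero_mul, add_zero] at this
  exact this.congr fun β => by ring

end VanishingDiscount

/-! ### Average cost of policies -/

/-- The average divides `m + 1` stage costs by `m`; neither the extra term nor the constant affects
the limit. -/
theorem tendsto_ofReal_affine_div (g C : ℝ) :
    Tendsto (fun m : ℕ => ENNReal.ofReal ((m + 1) * g + C) / (m : ENNReal)) atTop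
      (𝓝 (ENNReal.ofReal g)) := by
  have hreal : Tendsto (fun m : ℕ => g + (g + C) * (m : ℝ)⁻¹) atTop (𝓝 (g + (g + C) * 0)) :=
    (tendsto_inv_atTop_nhds_zero_nat.const_mul _).const_add _
  rw [mul_zero, add_zero] at hreal
  refine ((ENNReal.continuous_ofReal.tendsto _).comp hreal).congr' ?_
  filter_upwards [eventually_gt_atTop 0] with m hm
  have hm' : (0 : ℝ) < m := Nat.cast_pos.2 hm
  rw [Function.comp_apply, ← ENNReal.ofReal_natCast m, ← ENNReal.ofReal_div_of_pos hm']
  congr 1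
  field_simp
  ring

section Average

variable {U : ℕ → ℝ} {lam g : ℝ} {f : ℕ → ℝ}

theorem SolvesAverageEquation.le_averageCost (hs : SolvesAverageEquation U lam g f)
    (hU : ∀ Δ, 0 ≤ U Δ) (hlam : 0 ≤ lam) (μ : SensorPolicy) (Δ : ℕ) :
    ENNReal.ofReal g ≤ μ.averageCost (ageCost U lam) Δ := by
  let _ := μ.mΩ
  have := μ.prob
  rw [← (tendsto_ofReal_affine_div g (f Δ - lam)).limsup_eq]
  refine limsup_le_limsup (Eventually.of_forall fun m => ENNReal.div_le_div_right ?_ _)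
  calc ENNReal.ofReal ((m + 1) * g + (f Δ - lam))
      = ∫⁻ _, ENNReal.ofReal ((m + 1) * g + (f Δ - lam)) ∂μ.ℙ := by simp
    _ ≤ _ := by
      refine lintegral_mono fun ω => ?_
      rw [← ENNReal.ofReal_sum_of_nonneg fun k _ => ageCost_nonneg hU hlam _ _]
      refine ENNReal.ofReal_le_ofReal ?_
      simp only [SensorPolicy.age_eq_agePath]
      have := hs.le_sum_ageCost_succ hlam (fun j => μ.action Δ j ω) Δ m
      linarith

theorem SolvesAverageEquation.averageCost_thresholdPolicy
    (hs : SolvesAverageEquation U lam g f) (hU : ∀ Δ, 0 ≤ U Δ) (hlam : 0 ≤ lam) {η : ℕ∞}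
    (hη : ∀ Δ, g + f Δ
      = ageCost U lam Δ (thresholdAction η Δ) + f (nextAge Δ (thresholdAction η Δ))) (Δ : ℕ) :
    (thresholdPolicy η).averageCost (ageCost U lam) Δ = ENNReal.ofReal g := by
  refine le_antisymm ?_ (hs.le_averageCost hU hlam _ Δ)
  let _ := (thresholdPolicy η).mΩ
  have := (thresholdPolicy η).prob
  rw [← (tendsto_ofReal_affine_div g (f Δ - f 0)).limsup_eq]
  refine limsup_le_limsup (Eventually.of_forall fun m => ENNReal.div_le_div_right ?_ _)
  simp only [thresholdPolicy_age_action, lintegral_const, measure_univ, mul_one]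
  rw [← ENNReal.ofReal_sum_of_nonneg fun k _ => ageCost_nonneg hU hlam _ _]
  exact ENNReal.ofReal_le_ofReal (hs.sum_ageCost_closedLoop_le hη Δ m)

end Average

/-- Finite points of `ℕ∞` are isolated, so there the thresholds are eventually equal; if the limit
is `⊤`, they eventually exceed `Δ`. -/
theorem eventually_thresholdAction_eq {η : ℕ → ℕ∞} {ηbar : ℕ∞} (h : Tendsto η atTop (𝓝 ηbar))
    (Δ : ℕ) : ∀ᶠ ℓ in atTop, thresholdAction (η ℓ) Δ = thresholdAction ηbar Δ := by
  rcases eq_or_ne ηbar ⊤ with rfl | hne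
  · filter_upwards [ENat.tendsto_nhds_top_iff_natCast_lt.1 h Δ] with ℓ hℓ
    simp [thresholdAction, hℓ]
  · rw [ENat.nhds_eq_pure hne, tendsto_pure] at h
    filter_upwards [h] with ℓ hℓ
    rw [hℓ]

theorem theorem1 {n m₁ m₂ p : ℕ} (S : LQGame n m₁ m₂ p)
    (hQ : S.Q.PosSemidef) (hR₁ : S.R₁.PosDef) (hR₂ : S.R₂.PosDef)
    (P : Matrix (Fin n) (Fin n) ℝ) (hP : S.IsMinimalPSDSolution P)
    (h : ℝ) (hh : 0 < h) (lam : ℝ) (hlam : 0 ≤ lam) :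
    -- the discounted value function is finite
    (∀ β ∈ Ioo (0 : ℝ) 1, ∀ Δ : ℕ, discountedValue (S.Ubar P h lam) β Δ < ⊤) ∧
    ∃ (Vbar : ℝ) (f : ℕ → ℝ),
      -- vanishing-discount limit and relative value function
      (∀ Δ : ℕ, Tendsto (fun β : ℝ => (1 - β) * (discountedValue (S.Ubar P h lam) β Δ).toReal)
        (𝓝[<] 1) (𝓝 Vbar)) ∧
      (∀ Δ : ℕ, Tendsto (fun β : ℝ => (discountedValue (S.Ubar P h lam) β Δ).toReal
          - (discountedValue (S.Ubar P h lam) β 1).toReal)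
        (𝓝[<] 1) (𝓝 (f Δ))) ∧
      -- average-cost Bellman equation
      (∀ Δ : ℕ, Vbar + f Δ = min (S.Ubar P h lam Δ false + f (nextAge Δ false))
        (S.Ubar P h lam Δ true + f (nextAge Δ true))) ∧
      -- the construction of a limit threshold can be carried out along every sequence
      (∀ β : ℕ → ℝ, (∀ ℓ, β ℓ ∈ Ioo (0 : ℝ) 1) → Tendsto β atTop (𝓝 1) →
        (∀ ℓ, ∃ η, IsDiscountOptimalThreshold (S.Ubar P h lam) (β ℓ) η) ∧
        ∀ η : ℕ → ℕ∞, (∀ ℓ, IsDiscountOptimalThreshold (S.Ubar P h lam) (β ℓ) (η ℓ)) →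
          ∃ (φ : ℕ → ℕ) (ηbar : ℕ∞), StrictMono φ ∧ Tendsto (η ∘ φ) atTop (𝓝 ηbar)) ∧
      -- every limit threshold is average-cost optimal and attains the Bellman minimum
      (∀ ηbar : ℕ∞, IsLimitThreshold (S.Ubar P h lam) ηbar →
        (∀ Δ : ℕ, (thresholdPolicy ηbar).averageCost (S.Ubar P h lam) Δ = ENNReal.ofReal Vbar) ∧
        (∀ (μ : SensorPolicy) (Δ : ℕ),
          (thresholdPolicy ηbar).averageCost (S.Ubar P h lam) Δ
            ≤ μ.averageCost (S.Ubar P h lam) Δ) ∧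
        (∀ Δ : ℕ, Vbar + f Δ = S.Ubar P h lam Δ (thresholdAction ηbar Δ)
          + f (nextAge Δ (thresholdAction ηbar Δ)))) := by
  have hPpsd : P.PosSemidef := hP.1.1
  have hU : ∀ Δ, 0 ≤ S.U P h Δ := LQGame.U_nonneg hR₁ hPpsd hh.le
  have hmono : Monotone (S.U P h) := LQGame.U_monotone hR₁ hPpsd hh.le
  have hc : S.Ubar P h lam = ageCost (S.U P h) lam := rfl
  simp only [hc]
  set U := S.U P h
  have hval : ∀ β ∈ Ioo (0 : ℝ) 1,
      discountedValue (ageCost U lam) β = optimalPathCost (ageCost U lam) β :=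
    fun β hβ => discountedValue_eq_optimalPathCost hU hmono hlam hβ
  have hfin : ∀ β ∈ Ioo (0 : ℝ) 1, ∀ Δ, discountedValue (ageCost U lam) β Δ < ⊤ :=
    fun β hβ Δ => by rw [hval β hβ]; exact optimalPathCost_lt_top hU hlam hβ Δ
  obtain ⟨g, f, hs, hg, hf⟩ := exists_vanishing_discount_limit
    (V := fun β Δ => (discountedValue (ageCost U lam) β Δ).toReal) hlam hmono
    (fun β hβ Δ => by
      simp only [hval β hβ]; exact toReal_optimalPathCost_bellman hU hlam hβ Δ)
    (fun β hβ i j hij => by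
      refine ENNReal.toReal_mono (hfin β hβ j).ne ?_
      rw [hval β hβ]; exact optimalPathCost_monotone hmono hβ.1.le hij)
  refine ⟨hfin, g, f, hg, hf, hs.eq_min, fun β hβ _ =>
    ⟨fun ℓ => exists_isDiscountOptimalThreshold hU hmono hlam (hβ ℓ), fun η _ => ?_⟩, ?_⟩
  · obtain ⟨ηbar, φ, hφ, hlim⟩ := CompactSpace.tendsto_subseq η
    exact ⟨φ, ηbar, hφ, hlim⟩
  · rintro ηbar ⟨β, η, hβ, hβlim, hopt, hηlim⟩
    have hβ1 : Tendsto β atTop (𝓝[<] 1) :=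
      tendsto_nhdsWithin_iff.2 ⟨hβlim, Eventually.of_forall fun ℓ => (hβ ℓ).2⟩
    have hatt : ∀ Δ, g + f Δ = ageCost U lam Δ (thresholdAction ηbar Δ)
        + f (nextAge Δ (thresholdAction ηbar Δ)) := fun Δ => by
      set δ := thresholdAction ηbar Δ with hδ
      -- Both limits come from the conserving equation of `η ℓ` after subtracting `β ℓ` times the
      -- value at age one.
      have hleft := (hg 1).comp hβ1 |>.add ((hf Δ).comp hβ1)
      have hright := (hβlim.mul ((hf (nextAge Δ δ)).comp hβ1)).const_add (ageCost U lam Δ δ)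
      rw [one_mul] at hright
      refine tendsto_nhds_unique (hleft.congr' ?_) hright
      filter_upwards [eventually_thresholdAction_eq hηlim Δ] with ℓ hℓ
      have hv := (hopt ℓ).value_eq hU hmono hlam (hβ ℓ) Δ
      rw [hℓ, ← hδ] at hv
      simp only [Function.comp_apply]
      linarith
    have havg := hs.averageCost_thresholdPolicy hU hlam hatt
    exact ⟨havg, fun μ Δ => (havg Δ).trans_le (hs.le_averageCost hU hlam μ Δ), hatt⟩
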